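/- Let $k$ be an algebraically closed field of arbitrary characteristic and let $f=Y^n+B_1(X)Y^{n-1}+\cdots+B_n(X)\in k[[X]][Y]$, with $B_i(0)=0$ for $i=1,\dots,n$, be a Weierstrass polynomial of degree $n$ in $Y$ that is irreducible in $k[[X,Y]]$. For $g\in k[[X,Y]]$ let $\operatorname{I}(f,g)=\dim_k k[[X,Y]]/(f,g)\in\mathbb{N}\cup\{\infty\}$ be the intersection multiplicity. Let $I$ be an $\mathcal{M}$-primary ideal of $k[[X,Y]]$, where $\mathcal{M}=(X,Y)$. Then there is a natural number $N$, depending only on $f$ and $I$, such that every $h\in k[[X]][Y]$ of degree less than $n$ in $Y$ with $\operatorname{I}(f,h)\geqslant N$ lies in $I$. -/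

import Mathlib

/-- The inclusion `k[[X]] → k[[X, Y]]`. The variables of `k[[X, Y]] = MvPowerSeries (Fin 2) k`
are `X = MvPowerSeries.X 0` and `Y = MvPowerSeries.X 1`. -/
noncomputable def inclX (k : Type*) [Field k] : PowerSeries k →ₐ[k] MvPowerSeries (Fin 2) k :=
  MvPowerSeries.rename (fun _ : Unit => (0 : Fin 2))

/-- The inclusion `k[[X]][Y] → k[[X, Y]]`: evaluation of a polynomial over `k[[X]]` at `Y`. -/
noncomputable def polyIncl (k : Type*) [Field k] :
    Polynomial (PowerSeries k) →+* MvPowerSeries (Fin 2) k :=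
  Polynomial.eval₂RingHom (inclX k).toRingHom (MvPowerSeries.X 1)

/-- The intersection multiplicity `I(f, g) = dim_k k[[X, Y]] / (f, g)`, equal to `⊤` when the
quotient is infinite-dimensional. -/
noncomputable def intersectionMult {k : Type*} [Field k] (f g : MvPowerSeries (Fin 2) k) : ℕ∞ :=
  Cardinal.toENat (Module.rank k (MvPowerSeries (Fin 2) k ⧸ Ideal.span {f, g}))

/-- Weierstrass polynomials in `Y`: monic, with all other coefficients vanishing at `X = 0`. -/
def IsWeierstrassPoly {k : Type*} [Field k] (f : Polynomial (PowerSeries k)) : Prop :=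
  f.Monic ∧ ∀ i < f.natDegree, PowerSeries.constantCoeff (f.coeff i) = 0

/-- `I` is primary and its radical is the maximal ideal `(X, Y)` of `k[[X, Y]]`. -/
def IsMaxPrimary {k : Type*} [Field k] (I : Ideal (MvPowerSeries (Fin 2) k)) : Prop :=
  I.IsPrimary ∧ I.radical = Ideal.span {MvPowerSeries.X 0, MvPowerSeries.X 1}

/-! Choose `m` with `X ^ m ∈ I`. In the field `L = k((X))[Y]/(f)`, let `θ` be the class of `h`. As
`k((X))` is complete, the coefficients of `h` are bounded by a constant times `|θ|`. If `|θ|` is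
small, `X ^ m ∣ h`, so `h ∈ I`. Otherwise the norm of `θ` is bounded below, which puts a fixed `X ^
r` in `(f, h)` and bounds `I(f, h)` by the finite `dim k[[X, Y]]/(f, X ^ r)`. The dichotomy is
`Polynomial.Monic.exists_pow_mem_span_or_dvd`. -/

theorem MvPowerSeries.finite_quotient_of_X_pow_mem {k : Type*} [Field k] {r s : ℕ}
    {J : Ideal (MvPowerSeries (Fin 2) k)} (hX : MvPowerSeries.X 0 ^ r ∈ J)
    (hY : MvPowerSeries.X 1 ^ s ∈ J) :
    Module.Finite k (MvPowerSeries (Fin 2) k ⧸ J) := by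
  classical
  let S : Finset (Fin 2 →₀ ℕ) :=
    Finset.Iic (Finsupp.single 0 r + Finsupp.single 1 s)
  let φ : (S → k) →ₗ[k] MvPowerSeries (Fin 2) k ⧸ J :=
    (Ideal.Quotient.mkₐ k J).toLinearMap ∘ₗ ∑ d : S, MvPowerSeries.monomial d.1 ∘ₗ LinearMap.proj d
  refine Module.Finite.of_surjective φ fun z => ?_
  obtain ⟨p, rfl⟩ := Ideal.Quotient.mk_surjective z
  refine ⟨fun d => MvPowerSeries.coeff d.1 p, ?_⟩
  -- Outside the box `S`, the terms of `p` divisible by `X ^ r` form `a - b`; the others are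
  -- divisible by `Y ^ s`.
  let a : MvPowerSeries (Fin 2) k := fun d => if r ≤ d 0 then MvPowerSeries.coeff d p else 0
  have ha (d) : MvPowerSeries.coeff d a = if r ≤ d 0 then MvPowerSeries.coeff d p else 0 := rfl
  let t : MvPowerSeries (Fin 2) k := ∑ d : S, MvPowerSeries.monomial d.1 (MvPowerSeries.coeff d.1 p)
  have ht (d) : MvPowerSeries.coeff d t = if d ∈ S then MvPowerSeries.coeff d p else 0 := by
    simp only [t, map_sum, MvPowerSeries.coeff_monomial]
    rw [Finset.sum_coe_sort S (fun x => if d = x then MvPowerSeries.coeff x p else 0)]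
    simp
  have hS (d : Fin 2 →₀ ℕ) : d ∈ S ↔ d 0 ≤ r ∧ d 1 ≤ s := by
    simp [S, Finsupp.le_def, Fin.forall_fin_two]
  let b : MvPowerSeries (Fin 2) k :=
    fun d => if r ≤ d 0 ∧ d ∈ S then MvPowerSeries.coeff d p else 0
  have hb (d) : MvPowerSeries.coeff d b = if r ≤ d 0 ∧ d ∈ S then MvPowerSeries.coeff d p else 0 :=
    rfl
  have h1 : a - b ∈ J := by
    refine Ideal.mem_of_dvd _ (MvPowerSeries.X_pow_dvd_iff.2 fun d hd => ?_) hX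
    simp [ha, hb, hd.not_ge]
  have h2 : t - p + (a - b) ∈ J := by
    refine Ideal.mem_of_dvd _ (MvPowerSeries.X_pow_dvd_iff.2 fun d hd => ?_) hY
    simp only [map_add, map_sub, ht, ha, hb, hS]
    grind
  have h3 : φ (fun d => MvPowerSeries.coeff d.1 p) = Ideal.Quotient.mk J t := by
    simp [φ, t]
  rw [h3, Ideal.Quotient.mk_eq_mk_iff_sub_mem]
  simpa using J.sub_mem h2 h1

theorem inclX_X (k : Type*) [Field k] : inclX k PowerSeries.X = MvPowerSeries.X 0 :=
  MvPowerSeries.rename_X _ _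

theorem polyIncl_C {k : Type*} [Field k] (a : PowerSeries k) :
    polyIncl k (Polynomial.C a) = inclX k a := by
  simp [polyIncl]

theorem polyIncl_X {k : Type*} [Field k] :
    polyIncl k Polynomial.X = MvPowerSeries.X 1 := by
  simp [polyIncl]

theorem constantCoeff_inclX {k : Type*} [Field k] (a : PowerSeries k) :
    MvPowerSeries.constantCoeff (inclX k a) = PowerSeries.constantCoeff a :=
  MvPowerSeries.constantCoeff_rename (f := fun _ : Unit => (0 : Fin 2)) a

theorem constantCoeff_polyIncl {k : Type*} [Field k] (g : Polynomial (PowerSeries k)) :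
    MvPowerSeries.constantCoeff (polyIncl k g) = PowerSeries.constantCoeff (g.coeff 0) := by
  conv_lhs => rw [← g.divX_mul_X_add]
  simp [polyIncl_C, polyIncl_X, constantCoeff_inclX]

theorem isUnit_polyIncl_iff {k : Type*} [Field k] {g : Polynomial (PowerSeries k)} :
    IsUnit (polyIncl k g) ↔ PowerSeries.constantCoeff (g.coeff 0) ≠ 0 := by
  rw [MvPowerSeries.isUnit_iff_constantCoeff, constantCoeff_polyIncl, isUnit_iff_ne_zero]

theorem IsWeierstrassPoly.map_constantCoeff {k : Type*} [Field k] {f : Polynomial (PowerSeries k)}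
    (hf : IsWeierstrassPoly f) :
    f.map PowerSeries.constantCoeff = Polynomial.X ^ f.natDegree := by
  ext i
  rw [Polynomial.coeff_map, Polynomial.coeff_X_pow]
  rcases lt_trichotomy i f.natDegree with h | h | h
  · simp [hf.2 i h, h.ne]
  · simp [h, hf.1.coeff_natDegree]
  · simp [Polynomial.coeff_eq_zero_of_natDegree_lt h, h.ne']

/-- Modulo `X`, `a` is a monic divisor of `Y ^ n`, hence some `Y ^ i`; being a unit forces `i = 0`.
-/
theorem IsWeierstrassPoly.eq_one_of_dvd {k : Type*} [Field k] {f a : Polynomial (PowerSeries k)}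
    (hf : IsWeierstrassPoly f) (ha : a.Monic) (hdvd : a ∣ f) (hu : IsUnit (polyIncl k a)) :
    a = 1 := by
  rw [isUnit_polyIncl_iff, ← Polynomial.coeff_map] at hu
  have h := Polynomial.map_dvd PowerSeries.constantCoeff hdvd
  rw [hf.map_constantCoeff, dvd_prime_pow Polynomial.prime_X] at h
  obtain ⟨i, -, hi⟩ := h
  have hi' := Polynomial.eq_of_monic_of_associated (ha.map _) (Polynomial.monic_X_pow i) hi
  obtain rfl : i = 0 := by
    by_contra h0
    simp [hi', Ne.symm h0] at hu
  rw [← Polynomial.Monic.natDegree_eq_zero ha, ← ha.natDegree_map PowerSeries.constantCoeff, hi']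
  simp

theorem IsWeierstrassPoly.irreducible {k : Type*} [Field k] {f : Polynomial (PowerSeries k)}
    (hf : IsWeierstrassPoly f) (hirr : Irreducible (polyIncl k f)) : Irreducible f := by
  rw [Polynomial.irreducible_of_monic hf.1 (by rintro rfl; simp at hirr)]
  intro a b ha hb hab
  rw [← hab, map_mul] at hirr
  refine (hirr.isUnit_or_isUnit rfl).imp (hf.eq_one_of_dvd ha (hab ▸ dvd_mul_right a b))
    (hf.eq_one_of_dvd hb (hab ▸ dvd_mul_left b a))

/-- Since `f ≡ Y ^ n` modulo `X`, `Y ^ n` is a multiple of `X` modulo `f`. -/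
theorem IsWeierstrassPoly.X_pow_mem {k : Type*} [Field k] {f : Polynomial (PowerSeries k)}
    (hf : IsWeierstrassPoly f) (r : ℕ) :
    MvPowerSeries.X 1 ^ (f.natDegree * r) ∈
      Ideal.span {polyIncl k f, MvPowerSeries.X 0 ^ r} := by
  obtain ⟨g, hg⟩ : Polynomial.C PowerSeries.X ∣ f - Polynomial.X ^ f.natDegree := by
    rw [Polynomial.C_dvd_iff_dvd_coeff]
    intro i
    rw [PowerSeries.X_dvd_iff, ← Polynomial.coeff_map, Polynomial.map_sub, hf.map_constantCoeff]
    simp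
  have h := congr(polyIncl k $hg)
  simp only [map_sub, map_mul, map_pow, polyIncl_C, polyIncl_X, inclX_X] at h
  obtain ⟨u, hu⟩ : polyIncl k f ∣ (MvPowerSeries.X 1 ^ f.natDegree) ^ r -
      (MvPowerSeries.X 0 * -polyIncl k g) ^ r :=
    (Dvd.intro 1 (by linear_combination h)).trans (sub_dvd_pow_sub_pow _ _ r)
  rw [pow_mul, Ideal.mem_span_pair]
  exact ⟨u, (-polyIncl k g) ^ r, by rw [mul_pow] at hu; linear_combination -hu⟩

theorem IsWeierstrassPoly.finite_quotient {k : Type*} [Field k] {f : Polynomial (PowerSeries k)}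
    (hf : IsWeierstrassPoly f) (r : ℕ) :
    Module.Finite k
      (MvPowerSeries (Fin 2) k ⧸ Ideal.span {polyIncl k f, MvPowerSeries.X 0 ^ r}) :=
  MvPowerSeries.finite_quotient_of_X_pow_mem (r := r) (Ideal.subset_span (by simp)) (hf.X_pow_mem r)

theorem intersectionMult_le_finrank {k : Type*} [Field k] {f g h : MvPowerSeries (Fin 2) k}
    [Module.Finite k (MvPowerSeries (Fin 2) k ⧸ Ideal.span {f, g})]
    (hg : g ∈ Ideal.span {f, h}) :
    intersectionMult f h ≤
      Module.finrank k (MvPowerSeries (Fin 2) k ⧸ Ideal.span {f, g}) := by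
  have hle : Ideal.span {f, g} ≤ Ideal.span {f, h} := by
    rw [Ideal.span_le]
    rintro x (rfl | rfl)
    · exact Ideal.subset_span (by simp)
    · exact hg
  have hrank : Module.rank k (MvPowerSeries (Fin 2) k ⧸ Ideal.span {f, h}) ≤
      Module.rank k (MvPowerSeries (Fin 2) k ⧸ Ideal.span {f, g}) :=
    LinearMap.rank_le_of_surjective (Ideal.Quotient.factorₐ k hle).toLinearMap
      (Ideal.Quotient.factor_surjective hle)
  rw [← Module.finrank_eq_rank k (MvPowerSeries (Fin 2) k ⧸ Ideal.span {f, g})] at hrank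
  exact Cardinal.toENat_le_natCast.2 hrank

open Polynomial

theorem FiniteDimensional.exists_norm_linearMap_le_spectralNorm {K L ι : Type*}
    [NontriviallyNormedField K] [IsUltrametricDist K] [CompleteSpace K] [Field L] [Algebra K L]
    [FiniteDimensional K L] [Fintype ι] (φ : ι → L →ₗ[K] K) :
    ∃ C > 0, ∀ i x, ‖φ i x‖ ≤ C * spectralNorm K L x := by
  let := spectralNorm.normedField K L
  let := spectralNorm.normedAlgebra K L
  let Φ : L →L[K] (ι → K) := LinearMap.toContinuousLinearMap (LinearMap.pi φ)
  refine ⟨‖Φ‖ + 1, by positivity, fun i x => ?_⟩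
  calc ‖φ i x‖ ≤ ‖Φ x‖ := norm_le_pi_norm (Φ x) i
    _ ≤ ‖Φ‖ * ‖x‖ := Φ.le_opNorm x
    _ ≤ (‖Φ‖ + 1) * ‖x‖ := by gcongr; linarith

theorem Polynomial.C_coeff_zero_mem_span {A : Type*} [CommRing A] {f h p : A[X]}
    (hfp : f ∣ p.comp h) : C (p.coeff 0) ∈ Ideal.span {f, h} := by
  obtain ⟨u, hu⟩ := hfp
  have hcomp : p.comp h = p.divX.comp h * h + C (p.coeff 0) := by
    conv_lhs => rw [← p.divX_mul_X_add]
    simp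
  rw [Ideal.mem_span_pair]
  exact ⟨u, -p.divX.comp h, by linear_combination hcomp - hu⟩

theorem Polynomial.Monic.exists_pow_mem_span_or_dvd (K : Type*) {A : Type*}
    [NontriviallyNormedField K] [IsUltrametricDist K] [CompleteSpace K] [CommRing A] [IsDomain A]
    [IsIntegrallyClosed A] [Algebra A K] [IsFractionRing A K] {π : A} (hπ0 : π ≠ 0)
    (hπ : ‖algebraMap A K π‖ < 1)
    (hdvd : ∀ a b : A, ‖algebraMap A K a‖ ≤ ‖algebraMap A K b‖ → b ∣ a)
    {f : A[X]} (hf : f.Monic) (hirr : Irreducible f) (m : ℕ) :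
    ∃ r : ℕ, ∀ h : A[X], h.degree < f.degree → C (π ^ r) ∈ Ideal.span {f, h} ∨ C (π ^ m) ∣ h := by
  have hinj := IsFractionRing.injective A K
  let g : K[X] := f.map (algebraMap A K)
  have hg : g.Monic := hf.map _
  have hdeg : g.natDegree = f.natDegree := hf.natDegree_map _
  have : Fact (Irreducible g) := ⟨hf.irreducible_iff_irreducible_map_fraction_map.1 hirr⟩
  have : FiniteDimensional K (AdjoinRoot g) := (AdjoinRoot.powerBasis' hg).finite
  have hrank : Module.finrank K (AdjoinRoot g) = f.natDegree := by
    rw [(AdjoinRoot.powerBasis' hg).finrank, AdjoinRoot.powerBasis'_dim, hdeg]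
  obtain ⟨c, hc, hbound⟩ := FiniteDimensional.exists_norm_linearMap_le_spectralNorm
    (K := K) (L := AdjoinRoot g) fun i : Fin g.natDegree => (AdjoinRoot.powerBasisAux' hg).coord i
  let q : ℝ := ‖algebraMap A K π‖
  have hq : 0 < q := norm_pos_iff.2 ((map_ne_zero_iff _ hinj).2 hπ0)
  have hqpow (s : ℕ) : ‖algebraMap A K (π ^ s)‖ = q ^ s := by
    rw [map_pow, norm_pow]
  -- `q ^ m / c` forces the coefficients of `h` below `q ^ m`; the cap `1` gives `δ ^ n ≤ δ ^ d` for
  -- every degree `d ≤ n` of a minimal polynomial.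
  let δ : ℝ := min 1 (q ^ m / c)
  have hδ : 0 < δ := by positivity
  obtain ⟨r, hr⟩ := exists_pow_lt_of_lt_one (pow_pos hδ f.natDegree) hπ
  refine ⟨r, fun h hh => ?_⟩
  let θ : AdjoinRoot g := aeval (AdjoinRoot.root g) h
  have hθ : θ = AdjoinRoot.mk g (h.map (algebraMap A K)) := by
    rw [← AdjoinRoot.aeval_eq, aeval_map_algebraMap]
  by_cases hsmall : spectralNorm K (AdjoinRoot g) θ ≤ δ
  · right
    rw [C_dvd_iff_dvd_coeff]
    intro i
    rcases lt_or_ge i g.natDegree with hi | hi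
    · apply hdvd
      have hlt : (h.map (algebraMap A K)).degree < g.degree := by
        rwa [degree_map_eq_of_injective hinj, hf.degree_map]
      have hcoord : (AdjoinRoot.powerBasisAux' hg).coord ⟨i, hi⟩ θ =
          algebraMap A K (h.coeff i) := by
        rw [Module.Basis.coord_apply, AdjoinRoot.powerBasisAux'_repr_apply_to_fun, hθ,
          AdjoinRoot.modByMonicHom_mk, (modByMonic_eq_self_iff hg).2 hlt, coeff_map]
      rw [hqpow, ← hcoord]
      calc _ ≤ c * spectralNorm K (AdjoinRoot g) θ := hbound _ _
        _ ≤ c * (q ^ m / c) := by gcongr; exact hsmall.trans (min_le_right _ _)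
        _ = q ^ m := by field_simp
    · rw [coeff_eq_zero_of_degree_lt]
      · exact dvd_zero _
      · exact hh.trans_le (degree_le_natDegree.trans (by exact_mod_cast hdeg ▸ hi))
  · left
    push Not at hsmall
    -- Integrality puts the minimal polynomial of `θ` in `A[X]`; its constant term has norm `|θ| ^
    -- d` and lies in `(f, h)`.
    have hint : IsIntegral A θ := by
      refine adjoin_le_integralClosure ?_ (aeval_mem_adjoin_singleton A (AdjoinRoot.root g))
      refine ⟨f, hf, ?_⟩
      rw [← aeval_def, ← aeval_map_algebraMap K, AdjoinRoot.aeval_eq, AdjoinRoot.mk_self]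
    let p := minpoly A θ
    have hp : minpoly K θ = p.map (algebraMap A K) :=
      minpoly.isIntegrallyClosed_eq_field_fractions' K hint
    have hpdeg : (minpoly K θ).natDegree ≠ 0 := (minpoly.natDegree_pos hint.tower_top).ne'
    have hnorm : δ ^ f.natDegree ≤ ‖algebraMap A K (p.coeff 0)‖ := by
      calc δ ^ f.natDegree ≤ δ ^ (minpoly K θ).natDegree :=
            pow_le_pow_of_le_one hδ.le (min_le_left _ _) (hrank ▸ minpoly.natDegree_le θ)
        _ ≤ spectralNorm K (AdjoinRoot g) θ ^ (minpoly K θ).natDegree := by gcongr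
        _ = ‖(minpoly K θ).coeff 0‖ := by
          rw [spectralNorm.spectralNorm_eq_norm_coeff_zero_rpow, one_div,
            Real.rpow_inv_natCast_pow (norm_nonneg _) hpdeg]
        _ = _ := by rw [hp, coeff_map]
    have hpX : p.coeff 0 ∣ π ^ r := by
      apply hdvd
      rw [hqpow]
      exact hr.le.trans hnorm
    have hfp : f ∣ p.comp h := by
      rw [← map_dvd_map _ hinj hf, ← AdjoinRoot.mk_eq_zero, ← AdjoinRoot.aeval_eq,
        aeval_map_algebraMap, aeval_comp]
      exact minpoly.aeval _ _
    exact Ideal.mem_of_dvd _ (_root_.map_dvd C hpX) (C_coeff_zero_mem_span hfp)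

theorem PowerSeries.exists_X_pow_mem_span_or_dvd {k : Type*} [Field k] {f : (PowerSeries k)[X]}
    (hf : f.Monic) (hirr : Irreducible f) (m : ℕ) :
    ∃ r : ℕ, ∀ h : (PowerSeries k)[X], h.degree < f.degree →
      Polynomial.C (PowerSeries.X ^ r) ∈ Ideal.span {f, h} ∨ Polynomial.C (PowerSeries.X ^ m) ∣ h := by
  let v : Valuation (LaurentSeries k) (WithZero (Multiplicative ℤ)) := Valued.v
  have hX : v (algebraMap (PowerSeries k) _ PowerSeries.X) = WithZero.exp (-1 : ℤ) := by
    simpa using LaurentSeries.valuation_X_pow k 1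
  have hX0 : v (algebraMap (PowerSeries k) _ PowerSeries.X) ≠ 0 := by
    rw [hX]; exact WithZero.exp_ne_zero
  have hX1 : v (algebraMap (PowerSeries k) _ PowerSeries.X) < 1 := by
    rw [hX, ← WithZero.exp_zero, WithZero.exp_lt_exp]; norm_num
  have : v.IsNontrivial := ⟨_, hX0, hX1.ne⟩
  obtain ⟨hv⟩ : Nonempty v.RankOne :=
    Valuation.nonempty_rankOne_iff_mulArchimedean.2 inferInstance
  let := Valued.toNormedField (LaurentSeries k) (WithZero (Multiplicative ℤ))
  have hlt : ‖algebraMap (PowerSeries k) (LaurentSeries k) PowerSeries.X‖ < 1 :=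
    Valued.toNormedField.norm_lt_one_iff.2 hX1
  let : NontriviallyNormedField (LaurentSeries k) :=
    .ofNormNeOne ⟨_, v.ne_zero_iff.1 hX0, hlt.ne⟩
  refine hf.exists_pow_mem_span_or_dvd (LaurentSeries k) PowerSeries.X_ne_zero hlt
    (fun a b hab => ?_) hirr m
  have hinj := IsFractionRing.injective (PowerSeries k) (LaurentSeries k)
  by_cases hb : b = 0
  · have : a = 0 := by
      rw [hb, map_zero, norm_zero, norm_le_zero_iff] at hab
      exact (map_eq_zero_iff _ hinj).1 hab
    simp [this]
  have hb' : algebraMap (PowerSeries k) (LaurentSeries k) b ≠ 0 :=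
    (map_ne_zero_iff _ hinj).2 hb
  -- A Laurent series of valuation at most `1` is a power series.
  have : v (algebraMap (PowerSeries k) _ a / algebraMap (PowerSeries k) _ b) ≤ 1 := by
    rw [map_div₀]
    exact div_le_one_of_le₀ (Valued.toNormedField.norm_le_iff.1 hab) zero_le
  obtain ⟨c, hc⟩ := (LaurentSeries.val_le_one_iff_eq_coe k _).1 this
  refine ⟨c, HahnSeries.ofPowerSeries_injective (Γ := ℤ) ?_⟩
  rw [map_mul, hc]
  exact (mul_div_cancel₀ _ hb').symm

theorem proposition4p1 (k : Type*) [Field k] [IsAlgClosed k]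
    (f : Polynomial (PowerSeries k)) (n : ℕ)
    (hdeg : f.natDegree = n) (hW : IsWeierstrassPoly f) (hirr : Irreducible (polyIncl k f))
    (I : Ideal (MvPowerSeries (Fin 2) k)) (hI : IsMaxPrimary I) :
    ∃ N : ℕ, ∀ h : Polynomial (PowerSeries k), h.degree < (n : WithBot ℕ) →
      (N : ℕ∞) ≤ intersectionMult (polyIncl k f) (polyIncl k h) → polyIncl k h ∈ I := by
  obtain ⟨m, hm⟩ : MvPowerSeries.X 0 ∈ I.radical := hI.2 ▸ Ideal.subset_span (by simp)
  obtain ⟨r, hr⟩ := PowerSeries.exists_X_pow_mem_span_or_dvd hW.1 (hW.irreducible hirr) m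
  have := hW.finite_quotient r
  -- The `+ 1` excludes the case `X ^ r ∈ (f, h)`.
  refine ⟨Module.finrank k
    (MvPowerSeries (Fin 2) k ⧸ Ideal.span {polyIncl k f, MvPowerSeries.X 0 ^ r}) + 1,
    fun h hh hN => ?_⟩
  rcases hr h (by rwa [Polynomial.degree_eq_natDegree hW.1.ne_zero, hdeg]) with hmem | hdvd
  · have hmem' := Ideal.mem_map_of_mem (polyIncl k) hmem
    rw [Ideal.map_span, Set.image_pair, polyIncl_C, map_pow, inclX_X] at hmem'
    have := hN.trans (intersectionMult_le_finrank hmem')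
    norm_cast at this
    omega
  · have := map_dvd (polyIncl k) hdvd
    rw [polyIncl_C, map_pow, inclX_X] at this
    exact I.mem_of_dvd this hm
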